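/- For a topological space $Z$ and $n\ge 1$, let $\mathcal B_n(Z)$ be the set of Borel probability measures on $Z$ that are carried by at most $n$ points (convex combinations of at most $n$ Dirac measures), with the topology of weak convergence. For a map $f\colon E\to B$, let $$E_n=\{\mu\in\mathcal B_n(E)\;:\;\mu \text{ is carried by at most } n \text{ points of } f^{-1}(b)\text{ for some } b\in B\}$$ and let $f_n\colon E_n\to B$ be the map that sends such a $\mu$ to $b$. The distributional sectional category $\mathrm{dsecat}(f)\in\{0,1,2,\dots,\infty\}$ is the least integer $n\ge 0$ such that $f_{n+1}$ has a continuous section ($\infty$ if there is none). If $q^X\colon\widetilde X\to X$ is the universal covering of $X$, put $\mathrm{dcat}_1(X)=\mathrm{dsecat}(q^X)$. For $m\ge 2$, let $\pi\cong\pi_1(X)$ be the group of deck transformations of $q^X$, let $\widetilde X^m_\pi$ be the orbit space of the diagonal action of $\pi$ on $\widetilde X^m$, let $$r^X_m\colon \widetilde X^m_\pi\to X^m,\qquad [e_1,\dots,e_m]\mapsto (q^X(e_1),\dots,q^X(e_m)),$$ and put $\mathrm{dTC}^{\mathcal D}_m(X)=\mathrm{dsecat}(r^X_m)$. If $X$ has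 no universal covering, $\mathrm{dcat}_1(X)=\mathrm{dTC}^{\mathcal D}_m(X)=\infty$ by convention. **Proposition.** Let $X$ be a connected, locally path-connected, completely regular Hausdorff space (for example, a connected CW complex). Then, for every $m\ge 2$, $$\mathrm{dcat}_1(X^{m-1})\;\le\;\mathrm{dTC}^{\mathcal D}_m(X)\;\le\;\mathrm{dcat}_1(X^m),$$ where the powers of $X$ carry the product topology. -/

import Mathlib

open MeasureTheory

set_option linter.style.haveILetI false

universe u v w

/-- Borel probability measures on a topological space. -/
abbrev BorelProb (Z : Type u) [TopologicalSpace Z] : Type u :=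
  @ProbabilityMeasure Z (borel Z)

/-- The topology of weak convergence of probability measures. -/
noncomputable instance BorelProb.instTopologicalSpace (Z : Type u) [TopologicalSpace Z] :
    TopologicalSpace (BorelProb Z) :=
  letI : MeasurableSpace Z := borel Z
  haveI : BorelSpace Z := ⟨rfl⟩
  inferInstanceAs (TopologicalSpace (ProbabilityMeasure Z))

/-- The underlying measure. -/
def BorelProb.meas {Z : Type u} [TopologicalSpace Z] (μ : BorelProb Z) : @Measure Z (borel Z) :=
  @ProbabilityMeasure.toMeasure Z (borel Z) μ

/-- `μ` is carried by at most `n` points, all of which lie in the fibre `f ⁻¹(b)`, i.e.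
`μ` is a convex combination of at most `n` Dirac measures at points of `f ⁻¹(b)`. -/
def CarriedByFibre {E : Type u} {B : Type v} [TopologicalSpace E] (f : E → B) (n : ℕ)
    (μ : BorelProb E) (b : B) : Prop :=
  ∃ S : Finset E, S.card ≤ n ∧ (∀ e ∈ S, f e = b) ∧ μ.meas (S : Set E)ᶜ = 0

/-- A probability measure is carried by at most one fibre. -/
theorem CarriedByFibre.unique {E : Type u} {B : Type v} [TopologicalSpace E] {f : E → B} {n : ℕ}
    {μ : BorelProb E} {b b' : B} (h : CarriedByFibre f n μ b) (h' : CarriedByFibre f n μ b') :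
    b = b' := by
  obtain ⟨S, -, hS, h0⟩ := h
  obtain ⟨S', -, hS', h0'⟩ := h'
  by_contra hne
  have hunion : (S : Set E)ᶜ ∪ (S' : Set E)ᶜ = Set.univ := by
    ext e
    simp only [Set.mem_union, Set.mem_compl_iff, Finset.mem_coe, Set.mem_univ, iff_true]
    by_contra! hh
    exact hne ((hS e hh.1).symm.trans (hS' e hh.2))
  have h1 : μ.meas ((S : Set E)ᶜ ∪ (S' : Set E)ᶜ) = 0 := measure_union_null h0 h0'
  rw [hunion] at h1
  letI : MeasurableSpace E := borel E
  have h2 : (ProbabilityMeasure.toMeasure μ) Set.univ = 1 := measure_univ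
  exact one_ne_zero (h2.symm.trans h1)

/-- The space `E_n` of probability measures on `E` that are supported by at most `n` points of
a single fibre of `f : E → B`, with the subspace topology. -/
def FibreMeasures {E : Type u} (B : Type v) [TopologicalSpace E] (f : E → B) (n : ℕ) : Type u :=
  {μ : BorelProb E // ∃ b, CarriedByFibre f n μ b}

noncomputable instance FibreMeasures.instTopologicalSpace {E : Type u} (B : Type v)
    [TopologicalSpace E] (f : E → B) (n : ℕ) : TopologicalSpace (FibreMeasures B f n) :=
  inferInstanceAs (TopologicalSpace {μ : BorelProb E // ∃ b, CarriedByFibre f n μ b})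

/-- The projection `f_n : E_n → B`, which sends a measure to the point over which it lives. -/
noncomputable def fibreProj {E : Type u} {B : Type v} [TopologicalSpace E] (f : E → B) (n : ℕ)
    (μ : FibreMeasures B f n) : B :=
  Classical.choose μ.2

theorem fibreProj_eq_iff {E : Type u} {B : Type v} [TopologicalSpace E] (f : E → B) (n : ℕ)
    (μ : FibreMeasures B f n) (b : B) : fibreProj f n μ = b ↔ CarriedByFibre f n μ.1 b := by
  have h : CarriedByFibre f n μ.1 (fibreProj f n μ) := Classical.choose_spec μ.2
  exact ⟨fun e => e ▸ h, fun h' => h.unique h'⟩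

/-- `f_n : E_n → B` has a (continuous) section. -/
def HasFibreSection {E : Type u} {B : Type v} [TopologicalSpace E] [TopologicalSpace B]
    (f : E → B) (n : ℕ) : Prop :=
  ∃ s : B → FibreMeasures B f n, Continuous s ∧ ∀ b, fibreProj f n (s b) = b

/-- The distributional sectional category of `f`: the least `n` such that `f_{n+1}` has a section
(and `⊤` if there is no such `n`). -/
noncomputable def dsecat {E : Type u} {B : Type v} [TopologicalSpace E] [TopologicalSpace B]
    (f : E → B) : ℕ∞ :=
  sInf {k : ℕ∞ | ∃ n : ℕ, HasFibreSection f (n + 1) ∧ k = n}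

/-- A universal covering: a surjective covering map with simply connected total space. -/
structure IsUniversalCovering {E : Type u} {X : Type v} [TopologicalSpace E] [TopologicalSpace X]
    (q : E → X) : Prop where
  isCoveringMap : IsCoveringMap q
  surjective : Function.Surjective q
  simplyConnected : SimplyConnectedSpace E

/-- The distributional one-category `dcat₁(X) = dsecat(q)`, where `q` is the universal covering
of `X`. See `dcat1_eq_dsecat` for the independence of the choice of `q`. (The value is `⊤` if
`X` has no universal covering.) -/
noncomputable def dcat1 (X : Type u) [TopologicalSpace X] : ℕ∞ :=
  sInf {k : ℕ∞ | ∃ (E : Type u) (_ : TopologicalSpace E) (q : E → X),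
    IsUniversalCovering q ∧ k = dsecat q}

/-- The deck transformations of `q : E → X`. If `q` is the universal covering of `X`, this group
is isomorphic to the fundamental group of `X`. -/
def deckGroup {E : Type u} {X : Type v} [TopologicalSpace E] (q : E → X) :
    Subgroup (E ≃ₜ E) where
  carrier := {h | ∀ e, q (h e) = q e}
  mul_mem' {g h} hg hh e := (hg (h e)).trans (hh e)
  one_mem' _ := rfl
  inv_mem' {h} hh e := by
    have h1 := hh (h⁻¹ e)
    have h2 : h (h⁻¹ e) = e := h.apply_symm_apply e
    rw [h2] at h1
    exact h1.symm

/-- Two points of `E^m` are equivalent if they lie in one orbit of the diagonal action of the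
group of deck transformations. -/
def diagSetoid {E : Type u} {X : Type v} [TopologicalSpace E] (q : E → X) (m : ℕ) :
    Setoid (Fin m → E) where
  r a b := ∃ h ∈ deckGroup q, ∀ i, b i = h (a i)
  iseqv :=
    { refl := fun _ => ⟨1, (deckGroup q).one_mem, fun _ => rfl⟩
      symm := by
        rintro a b ⟨h, hh, hab⟩
        refine ⟨h⁻¹, (deckGroup q).inv_mem hh, fun i => ?_⟩
        rw [hab i]
        exact (h.symm_apply_apply (a i)).symm
      trans := by
        rintro a b c ⟨h, hh, hab⟩ ⟨g, hg, hbc⟩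
        refine ⟨g * h, (deckGroup q).mul_mem hg hh, fun i => ?_⟩
        rw [hbc i, hab i]
        rfl }

/-- The orbit space `E ×_π ⋯ ×_π E` of the diagonal action on `E^m`. -/
def DiagOrbitSpace {E : Type u} {X : Type v} [TopologicalSpace E] (q : E → X) (m : ℕ) : Type u :=
  Quotient (diagSetoid q m)

/-- The quotient topology of the product topology. -/
instance DiagOrbitSpace.instTopologicalSpace {E : Type u} {X : Type v} [TopologicalSpace E]
    (q : E → X) (m : ℕ) : TopologicalSpace (DiagOrbitSpace q m) :=
  inferInstanceAs (TopologicalSpace (Quotient (diagSetoid q m)))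

/-- The diagonal covering `r_m : E ×_π ⋯ ×_π E → X^m`, `[e₁, …, e_m] ↦ (q e₁, …, q e_m)`. -/
def diagCovering {E : Type u} {X : Type v} [TopologicalSpace E] (q : E → X) (m : ℕ) :
    DiagOrbitSpace q m → (Fin m → X) :=
  Quotient.lift (fun a i => q (a i)) (by
    rintro a b ⟨h, hh, hab⟩
    funext i
    rw [hab i]
    exact (hh (a i)).symm)

/-- The `m`-th sequential diagonal distributional complexity `dTC^D_m(X) = dsecat(r_m)`, where
`r_m` is the diagonal covering of `X^m` that is built from the universal covering `q` of `X`.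
See `dTCD_eq_dsecat` for the independence of the choice of `q`. (The value is `⊤` if `X` has no
universal covering.) -/
noncomputable def dTCD (m : ℕ) (X : Type u) [TopologicalSpace X] : ℕ∞ :=
  sInf {k : ℕ∞ | ∃ (E : Type u) (_ : TopologicalSpace E) (q : E → X),
    IsUniversalCovering q ∧ k = dsecat (diagCovering q m)}

/-- The distributional sectional category is invariant under homeomorphisms over the base. -/
theorem dsecat_le_of_homeomorph {E : Type u} {E' : Type w} {B : Type v} [TopologicalSpace E]
    [TopologicalSpace E'] [TopologicalSpace B] {f : E → B} {f' : E' → B} (φ : E ≃ₜ E')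
    (hf : ∀ e, f' (φ e) = f e) : dsecat f' ≤ dsecat f := by
  classical
  refine le_sInf ?_
  rintro k ⟨n, ⟨s, hs, hsb⟩, rfl⟩
  refine sInf_le ⟨n, ?_, rfl⟩
  letI : MeasurableSpace E := borel E
  haveI : BorelSpace E := ⟨rfl⟩
  letI : MeasurableSpace E' := borel E'
  haveI : BorelSpace E' := ⟨rfl⟩
  have hm : Measurable φ := φ.continuous.measurable
  have key : ∀ b, CarriedByFibre f' (n + 1)
      (show BorelProb E' from ProbabilityMeasure.map (s b).1 hm.aemeasurable) b := by
    intro b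
    obtain ⟨S, hc, hS, h0⟩ := (fibreProj_eq_iff f (n + 1) (s b) b).1 (hsb b)
    refine ⟨S.image φ, Finset.card_image_le.trans hc, ?_, ?_⟩
    · intro e he
      obtain ⟨a, ha, rfl⟩ := Finset.mem_image.1 he
      exact (hf a).trans (hS a ha)
    · have h1 : Measure.map φ (s b).1.meas ((S.image φ : Finset E') : Set E')ᶜ
          = (s b).1.meas (φ ⁻¹' ((S.image φ : Finset E') : Set E')ᶜ) :=
        φ.toMeasurableEquiv.map_apply _
      have h2 : φ ⁻¹' ((S.image φ : Finset E') : Set E')ᶜ = (S : Set E)ᶜ := by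
        ext e
        simp
      rw [h2, h0] at h1
      exact h1
  refine ⟨fun b => ⟨_, b, key b⟩, ?_, fun b => (fibreProj_eq_iff _ _ _ _).2 (key b)⟩
  refine Continuous.subtype_mk ?_ _
  have h1 : Continuous fun b => (s b).1 := continuous_subtype_val.comp hs
  exact (ProbabilityMeasure.continuous_map φ.continuous).comp h1

theorem dsecat_eq_of_homeomorph {E : Type u} {E' : Type w} {B : Type v} [TopologicalSpace E]
    [TopologicalSpace E'] [TopologicalSpace B] {f : E → B} {f' : E' → B} (φ : E ≃ₜ E')
    (hf : ∀ e, f' (φ e) = f e) : dsecat f' = dsecat f :=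
  le_antisymm (dsecat_le_of_homeomorph φ hf)
    (dsecat_le_of_homeomorph φ.symm fun e => by rw [← hf, φ.apply_symm_apply])

theorem IsUniversalCovering.locallyPathConnectedSpace {E : Type u} {X : Type v}
    [TopologicalSpace E] [TopologicalSpace X] [LocallyPathConnectedSpace X] {q : E → X}
    (hq : IsUniversalCovering q) : LocallyPathConnectedSpace E := by
  choose t ht hqt using hq.isCoveringMap.isLocalHomeomorph
  have h1 : ∀ e, LocallyPathConnectedSpace (t e).source := fun e =>
    (t e).isOpenEmbedding_restrict.locallyPathConnectedSpace
  let g : (Σ e, (t e).source) → E := fun p => p.2.1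
  have hg : IsOpenMap g := isOpenMap_sigma.2 fun e => (t e).open_source.isOpenMap_subtype_val
  have hc : Continuous g := continuous_sigma fun e => continuous_subtype_val
  exact (hg.isQuotientMap hc fun e => ⟨⟨e, e, ht e⟩, rfl⟩).locallyPathConnectedSpace

/-- Universal coverings of a locally path-connected space are unique up to homeomorphism. -/
theorem IsUniversalCovering.exists_homeomorph {E : Type u} {E' : Type w} {X : Type v}
    [TopologicalSpace E] [TopologicalSpace E'] [TopologicalSpace X] [LocallyPathConnectedSpace X]
    {q : E → X} {q' : E' → X} (hq : IsUniversalCovering q) (hq' : IsUniversalCovering q') :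
    ∃ φ : E ≃ₜ E', ∀ e, q' (φ e) = q e := by
  haveI := hq.simplyConnected
  haveI := hq'.simplyConnected
  haveI := hq.locallyPathConnectedSpace
  haveI := hq'.locallyPathConnectedSpace
  obtain ⟨e₀⟩ : Nonempty E := inferInstance
  obtain ⟨e₁, he₁⟩ := hq'.surjective (q e₀)
  obtain ⟨F, ⟨hF0, hF⟩, -⟩ := hq'.isCoveringMap.existsUnique_continuousMap_lifts
    ⟨q, hq.isCoveringMap.continuous⟩ e₀ e₁ he₁
  obtain ⟨G, ⟨hG0, hG⟩, -⟩ := hq.isCoveringMap.existsUnique_continuousMap_lifts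
    ⟨q', hq'.isCoveringMap.continuous⟩ e₁ e₀ he₁.symm
  have hF' : ∀ e, q' (F e) = q e := fun e => congrFun hF e
  have hG' : ∀ e, q (G e) = q' e := fun e => congrFun hG e
  have h1 : G ∘ F = id := hq.isCoveringMap.eq_of_comp_eq (G.continuous.comp F.continuous)
    continuous_id (funext fun e => by simp [hF', hG']) e₀ (by simp [hF0, hG0])
  have h2 : F ∘ G = id := hq'.isCoveringMap.eq_of_comp_eq (F.continuous.comp G.continuous)
    continuous_id (funext fun e => by simp [hF', hG']) e₁ (by simp [hF0, hG0])
  exact ⟨⟨⟨F, G, congrFun h1, congrFun h2⟩, F.continuous, G.continuous⟩, hF'⟩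

/-- `dcat₁(X)` can be computed with any universal covering of `X`. -/
theorem dcat1_eq_dsecat {E X : Type u} [TopologicalSpace E] [TopologicalSpace X]
    [LocallyPathConnectedSpace X] {q : E → X} (hq : IsUniversalCovering q) :
    dcat1 X = dsecat q := by
  refine le_antisymm (sInf_le ⟨E, _, q, hq, rfl⟩) (le_sInf ?_)
  rintro k ⟨E', _, q', hq', rfl⟩
  obtain ⟨φ, hφ⟩ := hq.exists_homeomorph hq'
  exact (dsecat_eq_of_homeomorph φ hφ).ge

/-- A homeomorphism over `X` induces a continuous map of diagonal orbit spaces. -/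
theorem exists_diagOrbitSpace_map {E : Type u} {E' : Type w} {X : Type v} [TopologicalSpace E]
    [TopologicalSpace E'] {q : E → X} {q' : E' → X} (φ : E ≃ₜ E') (hφ : ∀ e, q' (φ e) = q e)
    (m : ℕ) : ∃ ψ : DiagOrbitSpace q m → DiagOrbitSpace q' m, Continuous ψ ∧
      ∀ a, ψ (Quotient.mk _ a) = Quotient.mk _ (fun i => φ (a i)) := by
  have hφ' : ∀ e, q (φ.symm e) = q' e := fun e => by rw [← hφ, φ.apply_symm_apply]
  refine ⟨Quotient.lift (fun a => Quotient.mk (diagSetoid q' m) (fun i => φ (a i))) ?_, ?_,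
    fun _ => rfl⟩
  · rintro a b ⟨h, hh, hab⟩
    refine Quotient.sound ⟨(φ.symm.trans h).trans φ, fun e => ?_, fun i => ?_⟩
    · change q' (φ (h (φ.symm e))) = q' e
      rw [hφ, hh, hφ']
    · change φ (b i) = φ (h (φ.symm (φ (a i))))
      rw [hab i, φ.symm_apply_apply]
  · refine Continuous.quotient_lift (continuous_quotient_mk'.comp ?_) _
    exact continuous_pi fun i => φ.continuous.comp (continuous_apply i)

/-- `dTC^D_m(X)` can be computed with any universal covering of `X`. -/
theorem dTCD_eq_dsecat {E X : Type u} [TopologicalSpace E] [TopologicalSpace X]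
    [LocallyPathConnectedSpace X] {q : E → X} (hq : IsUniversalCovering q) (m : ℕ) :
    dTCD m X = dsecat (diagCovering q m) := by
  refine le_antisymm (sInf_le ⟨E, _, q, hq, rfl⟩) (le_sInf ?_)
  rintro k ⟨E', _, q', hq', rfl⟩
  obtain ⟨φ, hφ⟩ := hq.exists_homeomorph hq'
  have hφ' : ∀ e, q (φ.symm e) = q' e := fun e => by rw [← hφ, φ.apply_symm_apply]
  obtain ⟨ψ, hψ, hψ1⟩ := exists_diagOrbitSpace_map φ hφ m
  obtain ⟨χ, hχ, hχ1⟩ := exists_diagOrbitSpace_map φ.symm hφ' m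
  let Ψ : DiagOrbitSpace q m ≃ₜ DiagOrbitSpace q' m :=
    { toFun := ψ
      invFun := χ
      left_inv := by
        intro z
        induction z using Quotient.inductionOn with
        | h a => rw [hψ1, hχ1]; simp only [Homeomorph.symm_apply_apply]; rfl
      right_inv := by
        intro z
        induction z using Quotient.inductionOn with
        | h a => rw [hχ1, hψ1]; simp only [Homeomorph.apply_symm_apply]; rfl
      continuous_toFun := hψ
      continuous_invFun := hχ }
  refine (dsecat_eq_of_homeomorph Ψ fun z => ?_).ge
  induction z using Quotient.inductionOn with
  | h a =>
    change diagCovering q' m (ψ _) = _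
    rw [hψ1]
    exact funext fun i => hφ (a i)

/-! The upper bound is formal: the orbit map `E^m → E^m_π` lies over `X^m`, so push-forward along it
turns sections for `q^m` into sections for `r_m`. Any universal covering of `X^m` may be replaced by
`q^m` once `X` has a universal covering `q`. Such a `q` exists because the diagonal makes `X` a
retract of `X^m` (`IsUniversalCovering.exists_of_retract`).

For the lower bound, fix `e₀` and consider `r_m` over the slice `{q e₀} × X^(m-1)`. The deck group
acts freely, and transitively on fibres, so each orbit over the slice has exactly one representative
with first coordinate `e₀`. Hence `v ↦ [e₀, v]` identifies `E^(m-1)` with the part `A` of the orbit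
space over the slice. A section for `r_m`, restricted to the slice, yields measures carried by `A`,
and the inverse `T` of this identification moves them to `E^(m-1)`.

The difficulty is continuity: the measures vary weakly on the whole orbit space, while `T` is known
to be continuous on `A` only. `continuous_map_of_finite_support` uses that the supports are finite:
a test function can be matched at the finitely many atoms of one measure by a continuous function on
the whole space, and nearby measures have little mass away from these atoms. This requires the orbit
space to be completely regular and T1, properties that it inherits from `X^m` through relatively
clopen sheets (`IsUniversalCovering.exists_sheet_diagCovering`, `CompletelyRegularSpace.of_sheets`).
-/

/-! ### Weak continuity of push-forwards of finitely supported measures. -/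

section FiniteSupport

open Filter Topology BoundedContinuousFunction

/-- In a completely regular space, a finite set can be separated from the complement of any of its
neighbourhoods by a continuous function. -/
theorem exists_continuous_eqOn_zero_one {Z : Type*} [TopologicalSpace Z] [CompletelyRegularSpace Z]
    (S : Finset Z) {V : Set Z} (hV : IsOpen V) (hSV : (S : Set Z) ⊆ V) :
    ∃ f : Z → ℝ, Continuous f ∧ (∀ z, 0 ≤ f z ∧ f z ≤ 1) ∧ (∀ z ∈ S, f z = 0) ∧
      ∀ z ∉ V, f z = 1 := by
  classical
  induction S using Finset.induction_on with
  | empty => exact ⟨fun _ => 1, continuous_const, fun _ => by simp, by simp, fun _ _ => rfl⟩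
  | insert a S ha ih =>
    obtain ⟨f, hf, hf01, hf0, hf1⟩ := ih fun z hz => hSV (by simp [Finset.mem_coe.1 hz])
    obtain ⟨g, hg, hg0, hg1⟩ :=
      CompletelyRegularSpace.completely_regular_isOpen a V hV (hSV (by simp))
    refine ⟨fun z => g z * f z, (continuous_subtype_val.comp hg).mul hf, fun z =>
      ⟨mul_nonneg (g z).2.1 (hf01 z).1, mul_le_one₀ (g z).2.2 (hf01 z).1 (hf01 z).2⟩, ?_, ?_⟩
    · intro z hz
      rcases Finset.mem_insert.1 hz with rfl | hz
      · simp [hg0]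
      · simp [hf0 z hz]
    · intro z hz
      have : g z = 1 := hg1 hz
      simp [this, hf1 z hz]

/-- Interpolation by bounded continuous functions on a finite subset of a Tychonoff space. -/
theorem exists_boundedContinuousFunction_eqOn_finset {Z : Type*} [TopologicalSpace Z]
    [CompletelyRegularSpace Z] [T1Space Z] (S : Finset Z) (G : Z → ℝ) :
    ∃ h : Z →ᵇ ℝ, ∀ z ∈ S, h z = G z := by
  classical
  have key : ∀ a : Z, ∃ φ : Z →ᵇ ℝ, φ a = 1 ∧ ∀ z ∈ S.erase a, φ z = 0 := by
    intro a
    -- With `V = {a}ᶜ`, the value 1 off `V` is the value at `a`, so `f` is a Lagrange basis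
    -- function.
    obtain ⟨f, hf, hf01, hf0, hf1⟩ := exists_continuous_eqOn_zero_one (S.erase a)
      (V := {a}ᶜ) isOpen_compl_singleton (fun z hz => (Finset.mem_erase.1 hz).1)
    refine ⟨BoundedContinuousFunction.ofNormedAddCommGroup f hf 1 fun z => ?_, hf1 a (by simp), hf0⟩
    rw [Real.norm_eq_abs, abs_of_nonneg (hf01 z).1]
    exact (hf01 z).2
  choose φ hφ1 hφ0 using key
  refine ⟨∑ a ∈ S, G a • φ a, fun z hz => ?_⟩
  rw [BoundedContinuousFunction.sum_apply, Finset.sum_eq_single_of_mem z hz]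
  · simp [hφ1]
  · intro b _ hbz
    simp [hφ0 b z (Finset.mem_erase.2 ⟨hbz.symm, hz⟩)]

/-- Push-forward along a map that is continuous on `A` only is continuous on families of finitely
supported measures that are carried by `A`. -/
theorem continuous_map_of_finite_support {Z Y B : Type*} [TopologicalSpace Z]
    [CompletelyRegularSpace Z] [T1Space Z] [MeasurableSpace Z] [BorelSpace Z]
    [TopologicalSpace Y] [MeasurableSpace Y] [BorelSpace Y] [TopologicalSpace B] {A : Set Z}
    {T : Z → Y} (hT : Measurable T) (hTA : ContinuousOn T A) {s : B → ProbabilityMeasure Z}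
    (hs : Continuous s)
    (hfin : ∀ b, ∃ S : Finset Z, (S : Set Z) ⊆ A ∧ (s b : Measure Z) (S : Set Z)ᶜ = 0) :
    Continuous fun b => (s b).map hT.aemeasurable := by
  rw [continuous_iff_continuousAt]
  intro b₀
  refine ProbabilityMeasure.tendsto_iff_forall_integral_tendsto.2 fun g => ?_
  have hs0 := ProbabilityMeasure.tendsto_iff_forall_integral_tendsto.1 (hs.tendsto b₀)
  have hmap : ∀ b, ∫ y, g y ∂((s b).map hT.aemeasurable : Measure Y)
      = ∫ z, g (T z) ∂(s b : Measure Z) := fun b =>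
    integral_map hT.aemeasurable g.continuous.aestronglyMeasurable
  simp only [hmap]
  obtain ⟨S, hSA, hS⟩ := hfin b₀
  -- `g ∘ T` need not be continuous on `Z`, so weak convergence does not apply to it. The continuous
  -- substitute `h` has the same integral against `s b₀`; it remains to bound the error for nearby
  -- `b`.
  obtain ⟨h, hh⟩ := exists_boundedContinuousFunction_eqOn_finset S fun z => g (T z)
  have hgT : Measurable fun z => g (T z) := g.continuous.measurable.comp hT
  have hae : ∀ b, ∀ᵐ z ∂(s b : Measure Z), z ∈ A := by
    intro b
    obtain ⟨S', hS'A, hS'⟩ := hfin b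
    have : ∀ᵐ z ∂(s b : Measure Z), z ∈ (S' : Set Z) := hS'
    exact this.mono fun z hz => hS'A hz
  have hae0 : ∀ᵐ z ∂(s b₀ : Measure Z), z ∈ S := hS
  set M : ℝ := ‖g‖ + ‖h‖ with hM
  have hD : ∀ z, ‖g (T z) - h z‖ ≤ M := fun z =>
    (norm_sub_le _ _).trans (add_le_add (g.norm_coe_le_norm _) (h.norm_coe_le_norm _))
  have hgint : ∀ b, Integrable (fun z => g (T z)) (s b : Measure Z) := fun b =>
    Integrable.of_bound hgT.aestronglyMeasurable ‖g‖ (ae_of_all _ fun z => g.norm_coe_le_norm _)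
  have hhint : ∀ b, Integrable h (s b : Measure Z) := fun b => h.integrable _
  have hdiff : Tendsto (fun b => ∫ z, (g (T z) - h z) ∂(s b : Measure Z)) (𝓝 b₀) (𝓝 0) := by
    rw [Metric.tendsto_nhds]
    intro ε hε
    -- Points outside `A` satisfy the condition vacuously. This is harmless, since no measure `s b`
    -- charges them, and it makes `V` a neighbourhood of `S` in `Z` and not merely in `A`.
    let V : Set Z := interior {z | z ∈ A → ‖g (T z) - h z‖ < ε / 2}
    have hSV : (S : Set Z) ⊆ V := by
      intro x hx
      have hc : ContinuousWithinAt (fun z => ‖g (T z) - h z‖) A x :=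
        ((g.continuous.continuousAt.comp_continuousWithinAt (hTA x (hSA hx))).sub
          h.continuous.continuousWithinAt).norm
      have h0 : ‖g (T x) - h x‖ < ε / 2 := by
        rw [hh x hx, sub_self, norm_zero]
        exact half_pos hε
      exact mem_interior_iff_mem_nhds.2 (mem_nhdsWithin_iff_eventually.1 (hc.eventually_lt_const h0))
    obtain ⟨f, hf, hf01, hf0, hf1⟩ := exists_continuous_eqOn_zero_one S isOpen_interior hSV
    let F : Z →ᵇ ℝ := BoundedContinuousFunction.ofNormedAddCommGroup f hf 1 fun z => by
      rw [Real.norm_eq_abs, abs_of_nonneg (hf01 z).1]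
      exact (hf01 z).2
    have hF0 : ∫ z, F z ∂(s b₀ : Measure Z) = 0 :=
      integral_eq_zero_of_ae (hae0.mono fun z hz => hf0 z hz)
    -- On `A` the error is below `ε / 2` inside `V` and at most `M = M * F` outside, so this
    -- expression dominates its integral.
    have hlim : Tendsto (fun b => ε / 2 + M * ∫ z, F z ∂(s b : Measure Z)) (𝓝 b₀)
        (𝓝 (ε / 2)) := by
      have := ((hs0 F).const_mul M).const_add (ε / 2)
      rwa [hF0, mul_zero, add_zero] at this
    filter_upwards [hlim.eventually_lt_const (half_lt_self hε)] with b hb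
    rw [dist_zero_right]
    refine lt_of_le_of_lt ?_ hb
    refine (norm_integral_le_integral_norm _).trans ?_
    have hint : Integrable (fun z => ε / 2 + M * F z) (s b : Measure Z) :=
      (integrable_const _).add ((F.integrable _).const_mul M)
    have heq : ∫ z, (ε / 2 + M * F z) ∂(s b : Measure Z)
        = ε / 2 + M * ∫ z, F z ∂(s b : Measure Z) := by
      rw [integral_add (integrable_const _) ((F.integrable _).const_mul M), integral_const_mul]
      simp
    rw [← heq]
    refine integral_mono_ae ((hgint b).sub (hhint b)).norm hint ((hae b).mono fun z hz => ?_)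
    have hM0 : 0 ≤ M := by positivity
    by_cases hzV : z ∈ V
    · have h1 : ‖g (T z) - h z‖ < ε / 2 := interior_subset hzV hz
      have h2 : 0 ≤ M * F z := mul_nonneg hM0 (hf01 z).1
      simp only
      linarith
    · have h1 : F z = 1 := hf1 z hzV
      have h2 := hD z
      simp only [h1]
      linarith
  have hsum := (hs0 h).add hdiff
  have h0 : ∫ z, g (T z) ∂(s b₀ : Measure Z) = ∫ z, h z ∂(s b₀ : Measure Z) + 0 := by
    rw [add_zero]
    exact integral_congr_ae (hae0.mono fun z hz => (hh z hz).symm)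
  rw [h0]
  refine hsum.congr fun b => ?_
  rw [integral_sub (hgint b) (hhint b)]
  ring

/-- Push-forward of a measure carried by finitely many points of a fibre. -/
theorem CarriedByFibre.map {E : Type u} {E' : Type w} {B : Type v} {B' : Type*}
    [TopologicalSpace E] [TopologicalSpace E'] [T1Space E'] {f : E → B} {f' : E' → B'} {n : ℕ}
    {μ : BorelProb E} {b : B} {b' : B'} (h : CarriedByFibre f n μ b) {T : E → E'}
    (hT : @Measurable E E' (borel E) (borel E') T) (hTb : ∀ e, f e = b → f' (T e) = b') :
    CarriedByFibre f' n
      (@ProbabilityMeasure.map E E' (borel E) (borel E') μ T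
        (@Measurable.aemeasurable _ _ (borel E) (borel E') _ _ hT)) b' := by
  classical
  letI : MeasurableSpace E := borel E
  letI : MeasurableSpace E' := borel E'
  haveI : BorelSpace E' := ⟨rfl⟩
  obtain ⟨S, hc, hS, h0⟩ := h
  refine ⟨S.image T, Finset.card_image_le.trans hc, ?_, ?_⟩
  · intro e he
    obtain ⟨a, ha, rfl⟩ := Finset.mem_image.1 he
    exact hTb a (hS a ha)
  -- The T1 property of `E'` enters here: finite sets are closed, hence Borel.
  · have hm : MeasurableSet ((S.image T : Finset E') : Set E')ᶜ :=
      (Finset.finite_toSet _).isClosed.measurableSet.compl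
    have hsub : T ⁻¹' ((S.image T : Finset E') : Set E')ᶜ ⊆ (S : Set E)ᶜ := fun e he heS =>
      he (Finset.mem_coe.2 (Finset.mem_image_of_mem T heS))
    have h1 : Measure.map T μ.meas ((S.image T : Finset E') : Set E')ᶜ = 0 :=
      (Measure.map_apply hT hm).trans (measure_mono_null hsub h0)
    exact h1

/-- A section over `B` induces one over `B'` if there is a map of total spaces over a continuous
map `β : B' → B` that is continuous on the part of the total space over the range of `β`. -/
theorem HasFibreSection.pullback {E : Type u} {E' : Type w} {B : Type v} {B' : Type*}
    [TopologicalSpace E] [TopologicalSpace E'] [TopologicalSpace B] [TopologicalSpace B']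
    [CompletelyRegularSpace E] [T1Space E] [T1Space E'] {f : E → B} {f' : E' → B'} {n : ℕ}
    (h : HasFibreSection f n) {β : B' → B} (hβ : Continuous β) {T : E → E'}
    (hT : @Measurable E E' (borel E) (borel E') T)
    (hTc : ContinuousOn T (f ⁻¹' Set.range β))
    (hTb : ∀ e b', f e = β b' → f' (T e) = b') : HasFibreSection f' n := by
  letI : MeasurableSpace E := borel E
  haveI : BorelSpace E := ⟨rfl⟩
  letI : MeasurableSpace E' := borel E'
  haveI : BorelSpace E' := ⟨rfl⟩
  obtain ⟨s, hs, hsb⟩ := h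
  have hc : ∀ b', CarriedByFibre f n (s (β b')).1 (β b') := fun b' =>
    (fibreProj_eq_iff f n _ _).1 (hsb (β b'))
  have key : ∀ b', CarriedByFibre f' n
      (show BorelProb E' from ProbabilityMeasure.map (s (β b')).1 hT.aemeasurable) b' := fun b' =>
    (hc b').map hT fun e he => hTb e b' he
  refine ⟨fun b' => ⟨_, b', key b'⟩, ?_, fun b' => (fibreProj_eq_iff _ _ _ _).2 (key b')⟩
  refine Continuous.subtype_mk ?_ _
  have h1 : Continuous fun b' => ((s (β b')).1 : ProbabilityMeasure E) :=
    continuous_subtype_val.comp (hs.comp hβ)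
  refine continuous_map_of_finite_support hT hTc h1 fun b' => ?_
  obtain ⟨S, -, hS, h0⟩ := hc b'
  exact ⟨S, fun e he => ⟨b', (hS e he).symm⟩, h0⟩

/-- The distributional sectional category does not increase under maps over the base. -/
theorem dsecat_le_of_continuous {E : Type u} {E' : Type w} {B : Type v}
    [TopologicalSpace E] [TopologicalSpace E'] [TopologicalSpace B] [T1Space E']
    {f : E → B} {f' : E' → B} {p : E → E'} (hp : Continuous p) (hf : ∀ e, f' (p e) = f e) :
    dsecat f' ≤ dsecat f := by
  letI : MeasurableSpace E := borel E
  haveI : BorelSpace E := ⟨rfl⟩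
  letI : MeasurableSpace E' := borel E'
  haveI : BorelSpace E' := ⟨rfl⟩
  refine le_sInf ?_
  rintro k ⟨n, ⟨s, hs, hsb⟩, rfl⟩
  refine sInf_le ⟨n, ?_, rfl⟩
  have key : ∀ b, CarriedByFibre f' (n + 1)
      (show BorelProb E' from ProbabilityMeasure.map (s b).1 hp.measurable.aemeasurable) b :=
    fun b => ((fibreProj_eq_iff f (n + 1) _ _).1 (hsb b)).map hp.measurable
      fun e he => (hf e).trans he
  refine ⟨fun b => ⟨_, b, key b⟩, ?_, fun b => (fibreProj_eq_iff _ _ _ _).2 (key b)⟩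
  refine Continuous.subtype_mk ?_ _
  have h1 : Continuous fun b => ((s b).1 : ProbabilityMeasure E) := continuous_subtype_val.comp hs
  exact (ProbabilityMeasure.continuous_map hp).comp h1

end FiniteSupport

/-! ### Products, path components and retracts of coverings. -/

section Coverings

open Topology

/-- A finite product of covering maps is a covering map. -/
theorem IsCoveringMap.piMap {ι : Type*} [Finite ι] {E X : ι → Type*}
    [∀ i, TopologicalSpace (E i)] [∀ i, TopologicalSpace (X i)] {q : ∀ i, E i → X i}
    (hq : ∀ i, IsCoveringMap (q i)) : IsCoveringMap fun (a : ∀ i, E i) i => q i (a i) := by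
  intro x
  choose hI U hxU hU hqU H hH using fun i => hq i (x i)
  have hpre : (fun (a : ∀ i, E i) i => q i (a i)) ⁻¹' Set.univ.pi U
      = Set.univ.pi fun i => q i ⁻¹' U i := rfl
  refine IsEvenlyCovered.to_isEvenlyCovered_preimage (I := ∀ i, q i ⁻¹' {x i})
    ⟨inferInstance, Set.univ.pi U, fun i _ => hxU i, isOpen_set_pi Set.finite_univ fun i _ => hU i,
      hpre ▸ isOpen_set_pi Set.finite_univ fun i _ => hqU i,
      { toFun := fun a => (⟨fun i => q i (a.1 i), a.2⟩, fun i => (H i ⟨a.1 i, a.2 i trivial⟩).2)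
        invFun := fun p => ⟨fun i => ((H i).symm (⟨p.1.1 i, p.1.2 i trivial⟩, p.2 i)).1,
          fun i _ => ((H i).symm (⟨p.1.1 i, p.1.2 i trivial⟩, p.2 i)).2⟩
        left_inv := ?_
        right_inv := ?_
        continuous_toFun := ?_
        continuous_invFun := ?_ }, fun _ => rfl⟩
  · intro a
    refine Subtype.ext (funext fun i => ?_)
    have h1 : ((⟨q i (a.1 i), a.2 i trivial⟩ : U i), (H i ⟨a.1 i, a.2 i trivial⟩).2)
        = H i ⟨a.1 i, a.2 i trivial⟩ := Prod.ext (Subtype.ext (hH i ⟨_, _⟩).symm) rfl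
    simp only
    rw [h1, Homeomorph.symm_apply_apply]
  · rintro ⟨y, j⟩
    have h1 : ∀ i, q i ((H i).symm (⟨y.1 i, y.2 i trivial⟩, j i)).1 = y.1 i := fun i => by
      rw [← hH i, Homeomorph.apply_symm_apply]
    refine Prod.ext (Subtype.ext (funext h1)) (funext fun i => ?_)
    simp
  · refine Continuous.prodMk (Continuous.subtype_mk (continuous_pi fun i =>
      (hq i).continuous.comp ((continuous_apply i).comp continuous_subtype_val)) _)
      (continuous_pi fun i => continuous_snd.comp ((H i).continuous.comp ?_))
    exact ((continuous_apply i).comp continuous_subtype_val).subtype_mk _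
  · refine Continuous.subtype_mk (continuous_pi fun i =>
      continuous_subtype_val.comp ((H i).symm.continuous.comp (Continuous.prodMk ?_ ?_))) _
    · exact ((continuous_apply i).comp (continuous_subtype_val.comp continuous_fst)).subtype_mk _
    · exact (continuous_apply i).comp continuous_snd

/-- A covering map of a locally path-connected space restricts to a covering map on each path
component of the total space. -/
theorem IsCoveringMap.restrict_pathComponent {E X : Type*} [TopologicalSpace E]
    [TopologicalSpace X] [LocallyPathConnectedSpace X] {q : E → X} (hq : IsCoveringMap q) (e₀ : E) :
    IsCoveringMap fun e : pathComponent e₀ => q e := by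
  intro x
  obtain ⟨hI, U, hxU, hU, hqU, H, hH⟩ := hq x
  -- Sheets over the path-connected open set `V` are path-connected, so each lies inside the path
  -- component of `e₀` or misses it. The sheets of the restriction are those whose point over `x`
  -- lies in it.
  let V := pathComponentIn U x
  have hVU : V ⊆ U := pathComponentIn_subset
  have hV : IsOpen V := hU.pathComponentIn x
  have hxV : x ∈ V := mem_pathComponentIn_self hxU
  have hVc : IsPathConnected V := isPathConnected_pathComponentIn hxU
  have hqs : ∀ (y : U) i, q (H.symm (y, i)).1 = y := fun y i => by
    rw [← hH, Homeomorph.apply_symm_apply]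
  have hs : ∀ y (hy : y ∈ V) i,
      Joined (H.symm (⟨x, hxU⟩, i)).1 (H.symm (⟨y, hVU hy⟩, i)).1 := by
    intro y hy i
    have h1 := (hVc.joinedIn x hxV y hy).joined_subtype
    have hc : Continuous fun v : V => (H.symm (⟨v, hVU v.2⟩, i)).1 := by fun_prop
    exact h1.map hc
  have hHe : ∀ (e : E) (he : q e ∈ U), (H.symm (⟨q e, he⟩, (H ⟨e, he⟩).2)).1 = e := by
    intro e he
    have h1 : ((⟨q e, he⟩ : U), (H ⟨e, he⟩).2) = H ⟨e, he⟩ :=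
      Prod.ext (Subtype.ext (hH ⟨_, _⟩).symm) rfl
    rw [h1, Homeomorph.symm_apply_apply]
  have hqc := hq.continuous
  have hq' : Continuous fun e : pathComponent e₀ => q e := hqc.comp continuous_subtype_val
  refine IsEvenlyCovered.to_isEvenlyCovered_preimage
    (I := {i : q ⁻¹' {x} // (H.symm (⟨x, hxU⟩, i)).1 ∈ pathComponent e₀})
    ⟨inferInstance, V, hxV, hV, hV.preimage hq',
      { toFun := fun e => (⟨q e.1, e.2⟩, ⟨(H ⟨e.1.1, hVU e.2⟩).2, ?_⟩)
        invFun := fun p => ⟨⟨(H.symm (⟨p.1.1, hVU p.1.2⟩, p.2.1)).1, ?_⟩, ?_⟩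
        left_inv := ?_
        right_inv := ?_
        continuous_toFun := ?_
        continuous_invFun := ?_ }, fun _ => rfl⟩
  · have h1 := hs (q e.1) e.2 (H ⟨e.1.1, hVU e.2⟩).2
    rw [hHe e.1 (hVU e.2)] at h1
    exact Joined.mem_pathComponent h1.symm e.1.2
  · exact Joined.mem_pathComponent (hs p.1.1 p.1.2 p.2.1) p.2.2
  · change q _ ∈ V
    rw [hqs]
    exact p.1.2
  · intro e
    exact Subtype.ext (Subtype.ext (hHe e.1 (hVU e.2)))
  · rintro ⟨y, i⟩
    refine Prod.ext (Subtype.ext (hqs ⟨y, hVU y.2⟩ i)) (Subtype.ext ?_)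
    simp
  · refine Continuous.prodMk ((hq'.comp continuous_subtype_val).subtype_mk _)
      (Continuous.subtype_mk (continuous_snd.comp (H.continuous.comp ?_)) _)
    exact (continuous_subtype_val.comp continuous_subtype_val).subtype_mk _
  · refine Continuous.subtype_mk (Continuous.subtype_mk (continuous_subtype_val.comp
      (H.symm.continuous.comp (Continuous.prodMk ?_ ?_))) _) _
    · exact (continuous_subtype_val.comp continuous_fst).subtype_mk _
    · exact continuous_subtype_val.comp continuous_snd

/-- A covering map to a Hausdorff space has Hausdorff total space. -/
theorem IsCoveringMap.t2Space {E X : Type*} [TopologicalSpace E] [TopologicalSpace X] [T2Space X]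
    {q : E → X} (hq : IsCoveringMap q) : T2Space E := by
  refine ⟨fun a b hab => ?_⟩
  by_cases h : q a = q b
  · exact hq.isSeparatedMap a b h hab
  · exact separated_by_continuous hq.continuous h

theorem SimplyConnectedSpace.pi {ι : Type*} {E : ι → Type*} [∀ i, TopologicalSpace (E i)]
    [∀ i, SimplyConnectedSpace (E i)] : SimplyConnectedSpace (∀ i, E i) := by
  refine simply_connected_iff_paths_homotopic'.2 ⟨inferInstance, fun {x y} p₁ p₂ => ?_⟩
  have h : ∀ i, (p₁.map (continuous_apply i)).Homotopic (p₂.map (continuous_apply i)) :=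
    fun i => SimplyConnectedSpace.paths_homotopic _ _
  exact ⟨Path.Homotopic.piHomotopy _ _ fun i => (h i).some⟩

theorem IsUniversalCovering.pi {ι : Type*} [Finite ι] {E X : Type*}
    [TopologicalSpace E] [TopologicalSpace X] {q : E → X} (hq : IsUniversalCovering q) :
    IsUniversalCovering fun (a : ι → E) i => q (a i) where
  isCoveringMap := IsCoveringMap.piMap fun _ => hq.isCoveringMap
  surjective := fun x => ⟨fun i => (hq.surjective (x i)).choose,
    funext fun i => (hq.surjective (x i)).choose_spec⟩
  simplyConnected := by
    haveI := hq.simplyConnected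
    exact SimplyConnectedSpace.pi

/-- A path-connected, locally path-connected retract of a space with a universal covering has a
universal covering. -/
theorem IsUniversalCovering.exists_of_retract {E : Type u} {Y : Type v} {X : Type w}
    [TopologicalSpace E] [TopologicalSpace Y] [TopologicalSpace X] [PathConnectedSpace X]
    [LocallyPathConnectedSpace X] {p : E → Y} (hp : IsUniversalCovering p) {j : X → Y} {r : Y → X}
    (hj : Continuous j) (hr : Continuous r) (hrj : ∀ x, r (j x) = x) :
    ∃ (C : Type u) (_ : TopologicalSpace C) (q : C → X), IsUniversalCovering q := by
  haveI := hp.simplyConnected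
  let φ : Set.range j ≃ₜ X :=
    { toFun := fun y => r y
      invFun := fun x => ⟨j x, x, rfl⟩
      left_inv := by
        rintro ⟨_, x, rfl⟩
        exact Subtype.ext (congrArg j (hrj x))
      right_inv := hrj
      continuous_toFun := hr.comp continuous_subtype_val
      continuous_invFun := hj.subtype_mk _ }
  -- This is the pull-back of `p` along `j`; one of its path components will be the universal
  -- covering.
  let q₀ : p ⁻¹' Set.range j → X := φ ∘ (Set.range j).restrictPreimage p
  have hq₀ : IsCoveringMap q₀ := by
    have h1 := hp.isCoveringMap.restrictPreimage (Set.range j)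
    exact h1.homeomorph_comp φ
  obtain ⟨x₀⟩ : Nonempty X := inferInstance
  obtain ⟨e₀, he₀⟩ := hp.surjective (j x₀)
  let c₀ : p ⁻¹' Set.range j := ⟨e₀, x₀, he₀.symm⟩
  have hc₀ : q₀ c₀ = x₀ := by
    change r (p e₀) = x₀
    rw [he₀, hrj]
  let q : pathComponent c₀ → X := fun e => q₀ e
  have hq : IsCoveringMap q := hq₀.restrict_pathComponent c₀
  refine ⟨pathComponent c₀, inferInstance, q, hq, fun x => ?_, ?_⟩
  · let γ : Path x₀ x := PathConnectedSpace.somePath x₀ x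
    obtain ⟨Γ, hΓ, hΓ0⟩ := hq₀.exists_path_lifts γ.toContinuousMap c₀ (by simp [hc₀])
    refine ⟨⟨Γ 1, ⟨⟨Γ, hΓ0, rfl⟩⟩⟩, ?_⟩
    have h1 := congrFun hΓ 1
    simpa using h1
  · refine simply_connected_iff_paths_homotopic'.2
      ⟨isPathConnected_iff_pathConnectedSpace.1 isPathConnected_pathComponent, fun {a b} γ γ' => ?_⟩
    have hi : Continuous fun c : pathComponent c₀ => c.1.1 :=
      continuous_subtype_val.comp continuous_subtype_val
    have h1 : (γ.map hi).Homotopic (γ'.map hi) := SimplyConnectedSpace.paths_homotopic _ _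
    -- The covering `q` factors through the simply connected `E` as inclusion followed by `r ∘ p`.
    -- So `q` identifies parallel paths up to homotopy, and it is injective on homotopy classes.
    have h2 := h1.map ⟨fun e => r (p e), hr.comp hp.isCoveringMap.continuous⟩
    have h3 : (γ.map hq.continuous).Homotopic (γ'.map hq.continuous) := h2
    refine Path.Homotopic.Quotient.eq.1 (hq.injective_path_homotopic_map a b ?_)
    exact Path.Homotopic.Quotient.eq.2 h3

end Coverings

/-! ### Local sections, and separation axioms lifted through sheets. -/

section Sheets

open Topology

/-- Over the members of a neighbourhood basis, a covering map of a locally path-connected space has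
a section through each point. -/
theorem IsCoveringMap.exists_isOpen_isPathConnected_sections {E X : Type*} [TopologicalSpace E]
    [TopologicalSpace X] [LocallyPathConnectedSpace X] {q : E → X} (hq : IsCoveringMap q) (x : X)
    {O : Set X} (hO : O ∈ 𝓝 x) :
    ∃ U, IsOpen U ∧ IsPathConnected U ∧ x ∈ U ∧ U ⊆ O ∧ ∀ e, q e ∈ U →
      ∃ σ : X → E, ContinuousOn σ U ∧ (∀ y ∈ U, q (σ y) = y) ∧ σ (q e) = e := by
  classical
  obtain ⟨hI, V, hxV, hV, hqV, H, hH⟩ := hq x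
  obtain ⟨U, ⟨hU, hxU, hUc⟩, hUO⟩ :=
    (isOpen_isPathConnected_basis x).mem_iff.1 (Filter.inter_mem hO (hV.mem_nhds hxV))
  have hUV : U ⊆ V := fun y hy => (hUO hy).2
  refine ⟨U, hU, hUc, hxU, fun y hy => (hUO hy).1, fun e he => ?_⟩
  have heV : e ∈ q ⁻¹' V := hUV he
  -- The section keeps the fibre coordinate of `e` constant; its value off `U` is arbitrary.
  refine ⟨fun y => if hy : y ∈ U then (H.symm (⟨y, hUV hy⟩, (H ⟨e, heV⟩).2)).1 else e,
    ?_, fun y hy => ?_, ?_⟩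
  · rw [continuousOn_iff_continuous_domRestrict]
    have h1 : Continuous fun y : U => (H.symm (⟨y, hUV y.2⟩, (H ⟨e, heV⟩).2)).1 := by fun_prop
    refine h1.congr fun y => ?_
    simp
  · simp only [hy, dif_pos]
    rw [← hH, Homeomorph.apply_symm_apply]
  · have h1 : ((⟨q e, heV⟩ : V), (H ⟨e, heV⟩).2) = H ⟨e, heV⟩ :=
      Prod.ext (Subtype.ext (hH ⟨_, _⟩).symm) rfl
    simp only [he, dif_pos]
    rw [h1, Homeomorph.symm_apply_apply]

/-- The image of a local section of a local homeomorphism is open. -/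
theorem IsLocalHomeomorph.isOpen_image_section {E X : Type*} [TopologicalSpace E]
    [TopologicalSpace X] {q : E → X} (hq : IsLocalHomeomorph q) {U : Set X} (hU : IsOpen U)
    {σ : X → E} (hσ : ContinuousOn σ U) (hqσ : ∀ y ∈ U, q (σ y) = y) : IsOpen (σ '' U) := by
  have h1 : IsLocalHomeomorph (q ∘ U.domRestrict σ) := by
    have : q ∘ U.domRestrict σ = Subtype.val := funext fun y => hqσ y y.2
    rw [this]
    exact hU.isOpenEmbedding_subtypeVal.isLocalHomeomorph
  have h2 := (IsLocalHomeomorph.of_comp h1 hq (continuousOn_iff_continuous_domRestrict.1 hσ)).isOpenMap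
  rw [← Set.range_domRestrict]
  exact h2.isOpen_range

/-- A space over a completely regular space is completely regular if each of its points has
arbitrarily small neighbourhoods that are open and closed in the preimage of an open set. -/
theorem CompletelyRegularSpace.of_sheets {E B : Type*} [TopologicalSpace E] [TopologicalSpace B]
    [CompletelyRegularSpace B] {f : E → B} (hf : Continuous f)
    (h : ∀ e, ∀ N ∈ 𝓝 e, ∃ (U : Set B) (W : Set E), IsOpen U ∧ IsOpen W ∧ e ∈ W ∧ W ⊆ N ∧
      W ⊆ f ⁻¹' U ∧ Set.InjOn f W ∧ IsOpen (f ⁻¹' U \ W)) : CompletelyRegularSpace E := by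
  classical
  rw [completelyRegularSpace_iff_isOpen]
  intro e K hK heK
  obtain ⟨U, W, hU, hW, heW, hWK, hWU, -, hUW⟩ := h e K (hK.mem_nhds heK)
  obtain ⟨φ, hφ, hφ0, hφ1⟩ := CompletelyRegularSpace.completely_regular_isOpen (f e) U hU (hWU heW)
  have hφf : Continuous fun a => φ (f a) := hφ.comp hf
  refine ⟨fun a => if a ∈ W then φ (f a) else 1, ?_, by simp [heW, hφ0], fun a ha => ?_⟩
  · rw [continuous_iff_continuousAt]
    intro a
    by_cases haW : a ∈ W
    · refine hφf.continuousAt.congr ?_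
      filter_upwards [hW.mem_nhds haW] with b hb
      simp [hb]
    · by_cases haU : f a ∈ U
      · refine (continuousAt_const (y := 1)).congr ?_
        filter_upwards [hUW.mem_nhds ⟨haU, haW⟩] with b hb
        simp [hb.2]
      · have h1 : φ (f a) = 1 := hφ1 haU
        have h2 : Filter.Tendsto (fun a => φ (f a)) (𝓝 a) (𝓝 1) := by
          have := hφf.tendsto a
          rwa [h1] at this
        have h3 : ContinuousAt (fun a => if a ∈ W then φ (f a) else 1) a ↔
            Filter.Tendsto (fun a => if a ∈ W then φ (f a) else 1) (𝓝 a) (𝓝 1) := by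
          rw [ContinuousAt, if_neg haW]
        rw [h3]
        -- Here `a` may be a boundary point of `W` lying over the boundary of `U`; the function is
        -- squeezed between `φ ∘ f`, which tends to 1, and 1.
        refine tendsto_of_tendsto_of_tendsto_of_le_of_le h2 tendsto_const_nhds (fun b => ?_)
          fun b => unitInterval.le_one'
        by_cases hb : b ∈ W
        · simp [hb]
        · simpa [hb] using unitInterval.le_one'
  · have : a ∉ W := fun haW => ha (hWK haW)
    simp [this]

/-- Points of different fibres are separated in the base; within a fibre, a sheet through one point
misses the other by injectivity. -/
theorem T1Space.of_sheets {E B : Type*} [TopologicalSpace E] [TopologicalSpace B]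
    [T1Space B] {f : E → B} (hf : Continuous f)
    (h : ∀ e, ∀ N ∈ 𝓝 e, ∃ (U : Set B) (W : Set E), IsOpen U ∧ IsOpen W ∧ e ∈ W ∧ W ⊆ N ∧
      W ⊆ f ⁻¹' U ∧ Set.InjOn f W ∧ IsOpen (f ⁻¹' U \ W)) : T1Space E := by
  rw [t1Space_iff_exists_open]
  intro a b hab
  by_cases hfab : f a = f b
  · obtain ⟨U, W, -, hW, haW, -, -, hinj, -⟩ := h a Set.univ Filter.univ_mem
    exact ⟨W, hW, haW, fun hbW => hab (hinj haW hbW hfab)⟩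
  · exact ⟨f ⁻¹' {f b}ᶜ, isOpen_compl_singleton.preimage hf, hfab, fun h => h rfl⟩

end Sheets

/-! ### Deck transformations and the diagonal orbit space. -/

section DeckTransformations

open Topology

/-- The deck transformations of a universal covering act transitively on the fibres. -/
theorem IsUniversalCovering.exists_deckGroup_apply_eq {E : Type u} {X : Type v}
    [TopologicalSpace E] [TopologicalSpace X] [LocallyPathConnectedSpace X] {q : E → X}
    (hq : IsUniversalCovering q) {a b : E} (hab : q a = q b) : ∃ h ∈ deckGroup q, h a = b := by
  haveI := hq.simplyConnected
  haveI := hq.locallyPathConnectedSpace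
  obtain ⟨F, ⟨hF0, hF⟩, -⟩ := hq.isCoveringMap.existsUnique_continuousMap_lifts
    ⟨q, hq.isCoveringMap.continuous⟩ a b hab.symm
  obtain ⟨G, ⟨hG0, hG⟩, -⟩ := hq.isCoveringMap.existsUnique_continuousMap_lifts
    ⟨q, hq.isCoveringMap.continuous⟩ b a hab
  have hF' : ∀ e, q (F e) = q e := fun e => congrFun hF e
  have hG' : ∀ e, q (G e) = q e := fun e => congrFun hG e
  have h1 : G ∘ F = id := hq.isCoveringMap.eq_of_comp_eq (G.continuous.comp F.continuous)
    continuous_id (funext fun e => by simp [hF', hG']) a (by simp [hF0, hG0])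
  have h2 : F ∘ G = id := hq.isCoveringMap.eq_of_comp_eq (F.continuous.comp G.continuous)
    continuous_id (funext fun e => by simp [hF', hG']) b (by simp [hF0, hG0])
  exact ⟨⟨⟨F, G, congrFun h1, congrFun h2⟩, F.continuous, G.continuous⟩, hF', hF0⟩

/-- The deck transformations of a universal covering act freely. -/
theorem IsUniversalCovering.deckGroup_apply_eq_self {E : Type u} {X : Type v}
    [TopologicalSpace E] [TopologicalSpace X] {q : E → X} (hq : IsUniversalCovering q) {h : E ≃ₜ E}
    (hh : h ∈ deckGroup q) {a : E} (ha : h a = a) (e : E) : h e = e := by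
  haveI := hq.simplyConnected
  exact congrFun (hq.isCoveringMap.eq_of_comp_eq h.continuous continuous_id
    (funext fun e => hh e) a ha) e

theorem DiagOrbitSpace.continuous_mk {E : Type u} {X : Type v} [TopologicalSpace E]
    (q : E → X) (m : ℕ) : Continuous (Quotient.mk (diagSetoid q m) : _ → DiagOrbitSpace q m) :=
  continuous_quotient_mk'

/-- The saturation of an open set is the union of its preimages under deck transformations. -/
theorem DiagOrbitSpace.isOpenMap_mk {E : Type u} {X : Type v} [TopologicalSpace E]
    (q : E → X) (m : ℕ) : IsOpenMap (Quotient.mk (diagSetoid q m) : _ → DiagOrbitSpace q m) := by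
  intro V hV
  refine isQuotientMap_quotient_mk'.isOpen_preimage.1 ?_
  have h1 : Quotient.mk (diagSetoid q m) ⁻¹' (Quotient.mk (diagSetoid q m) '' V)
      = ⋃ h ∈ deckGroup q, {b | (fun i => h (b i)) ∈ V} := by
    ext b
    simp only [Set.mem_preimage, Set.mem_image, Set.mem_iUnion, Set.mem_ofPred_eq, exists_prop]
    constructor
    · rintro ⟨a, ha, hab⟩
      obtain ⟨h, hh, hha⟩ := Quotient.exact hab.symm
      have : (fun i => h (b i)) = a := funext fun i => (hha i).symm
      exact ⟨h, hh, this ▸ ha⟩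
    · rintro ⟨h, hh, hb⟩
      exact ⟨_, hb, (Quotient.sound ⟨h, hh, fun _ => rfl⟩ :
        Quotient.mk (diagSetoid q m) b = Quotient.mk _ _).symm⟩
  change IsOpen (Quotient.mk (diagSetoid q m) ⁻¹' (Quotient.mk (diagSetoid q m) '' V))
  rw [h1]
  refine isOpen_biUnion fun h _ => hV.preimage ?_
  exact continuous_pi fun i => h.continuous.comp (continuous_apply i)

theorem continuous_diagCovering {E : Type u} {X : Type v} [TopologicalSpace E] [TopologicalSpace X]
    {q : E → X} (hq : Continuous q) (m : ℕ) : Continuous (diagCovering q m) :=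
  Continuous.quotient_lift (continuous_pi fun i => hq.comp (continuous_apply i)) _

/-- The sheets of the diagonal covering. -/
theorem IsUniversalCovering.exists_sheet_diagCovering {E : Type u} {X : Type v}
    [TopologicalSpace E] [TopologicalSpace X] [LocallyPathConnectedSpace X] {q : E → X}
    (hq : IsUniversalCovering q) (m : ℕ) (z : DiagOrbitSpace q m) (N : Set (DiagOrbitSpace q m))
    (hN : N ∈ 𝓝 z) :
    ∃ (U : Set (Fin m → X)) (W : Set (DiagOrbitSpace q m)), IsOpen U ∧ IsOpen W ∧ z ∈ W ∧ W ⊆ N ∧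
      W ⊆ diagCovering q m ⁻¹' U ∧ Set.InjOn (diagCovering q m) W ∧
      IsOpen (diagCovering q m ⁻¹' U \ W) := by
  let Q : (Fin m → E) → (Fin m → X) := fun a i => q (a i)
  have hQ : IsCoveringMap Q := IsCoveringMap.piMap fun _ => hq.isCoveringMap
  let mk : (Fin m → E) → DiagOrbitSpace q m := Quotient.mk (diagSetoid q m)
  have hmk : Continuous mk := DiagOrbitSpace.continuous_mk q m
  have hmk' : IsOpenMap mk := DiagOrbitSpace.isOpenMap_mk q m
  obtain ⟨a, rfl⟩ : ∃ a, mk a = z := Quotient.exists_rep z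
  have hN' : interior (mk ⁻¹' N) ∈ 𝓝 a := interior_mem_nhds.2 (hmk.continuousAt hN)
  obtain ⟨φ, haφ, hφ⟩ := hQ.isLocalHomeomorph a
  have hφQ : ∀ b, φ b = Q b := fun b => (congrFun hφ b).symm
  -- Choosing `U` inside this image makes `φ.symm` a section over `U` that lands in the preimage of
  -- `N`.
  have hO : φ '' (φ.source ∩ interior (mk ⁻¹' N)) ∈ 𝓝 (Q a) := by
    rw [← hφQ]
    refine (φ.isOpen_image_of_subset_source (φ.open_source.inter isOpen_interior)
      Set.inter_subset_left).mem_nhds ⟨a, ⟨haφ, mem_of_mem_nhds hN'⟩, rfl⟩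
  obtain ⟨U, hU, hUc, haU, hUO, hσ⟩ := hQ.exists_isOpen_isPathConnected_sections (Q a) hO
  have hσ₁ : ∀ y ∈ U, Q (φ.symm y) = y ∧ mk (φ.symm y) ∈ N ∧ y ∈ φ.target := by
    intro y hy
    obtain ⟨b, ⟨hb, hbN⟩, rfl⟩ := hUO hy
    rw [φ.left_inv hb]
    have hbN' : b ∈ mk ⁻¹' N := interior_subset hbN
    exact ⟨(hφQ b).symm, hbN', φ.map_source hb⟩
  have hσ₁c : ContinuousOn φ.symm U := φ.continuousOn_symm.mono fun y hy => (hσ₁ y hy).2.2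
  have hσ₁a : φ.symm (Q a) = a := by rw [← hφQ, φ.left_inv haφ]
  have hr : ∀ b, diagCovering q m (mk b) = Q b := fun _ => rfl
  refine ⟨U, mk '' (φ.symm '' U), hU, hmk' _ (hQ.isLocalHomeomorph.isOpen_image_section hU hσ₁c
    fun y hy => (hσ₁ y hy).1), ⟨a, ⟨Q a, haU, hσ₁a⟩, rfl⟩, ?_, ?_, ?_, ?_⟩
  · rintro _ ⟨_, ⟨y, hy, rfl⟩, rfl⟩
    exact (hσ₁ y hy).2.1
  · rintro _ ⟨_, ⟨y, hy, rfl⟩, rfl⟩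
    rw [Set.mem_preimage, hr, (hσ₁ y hy).1]
    exact hy
  · rintro _ ⟨_, ⟨y, hy, rfl⟩, rfl⟩ _ ⟨_, ⟨y', hy', rfl⟩, rfl⟩ h
    rw [hr, hr, (hσ₁ y hy).1, (hσ₁ y' hy').1] at h
    rw [h]
  · refine isQuotientMap_quotient_mk'.isOpen_preimage.1 ?_
    change IsOpen (mk ⁻¹' (diagCovering q m ⁻¹' U \ mk '' (φ.symm '' U)))
    rw [isOpen_iff_mem_nhds]
    rintro b ⟨hbU : Q b ∈ U, hbW⟩
    obtain ⟨σ, hσc, hσQ, hσb⟩ := hσ b hbU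
    refine Filter.mem_of_superset
      ((hQ.isLocalHomeomorph.isOpen_image_section hU hσc hσQ).mem_nhds ⟨Q b, hbU, hσb⟩) ?_
    rintro _ ⟨y, hy, rfl⟩
    refine ⟨?_, ?_⟩
    · change Q (σ y) ∈ U
      rw [hσQ y hy]
      exact hy
    · rintro ⟨_, ⟨y', hy', rfl⟩, hyy'⟩
      have hy'y : y' = y := by
        have h1 := congrArg (diagCovering q m) hyy'
        rwa [hr, hr, (hσ₁ y' hy').1, hσQ y hy] at h1
      subst hy'y
      obtain ⟨h, hh, hhσ⟩ := Quotient.exact hyy'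
      have hhc : Continuous fun (c : Fin m → E) i => h (c i) :=
        continuous_pi fun i => h.continuous.comp (continuous_apply i)
      have hhQ : ∀ c, Q (fun i => h (c i)) = Q c := fun c => funext fun i => hh (c i)
      -- If the sheet through `b` meets a translate of the sheet through `a`, uniqueness of lifts
      -- over the connected `U` makes them coincide, contradicting `hbW`.
      have heq := hQ.eqOn_of_comp_eqOn hUc.isConnected.isPreconnected hσc
        (hhc.comp_continuousOn hσ₁c)
        (fun t ht => by simp only [Function.comp_apply, hhQ, hσQ t ht, (hσ₁ t ht).1])
        hy (funext hhσ)
      have h2 : b = fun i => h (φ.symm (Q b) i) := hσb.symm.trans (heq hbU)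
      refine hbW ⟨φ.symm (Q b), ⟨Q b, hbU, rfl⟩, ?_⟩
      exact Quotient.sound ⟨h, hh, fun i => congrFun h2 i⟩

/-- Supplies the separating functions on the orbit space that `HasFibreSection.pullback` needs. -/
theorem IsUniversalCovering.completelyRegularSpace_diagOrbitSpace {E : Type u} {X : Type v}
    [TopologicalSpace E] [TopologicalSpace X] [LocallyPathConnectedSpace X]
    [CompletelyRegularSpace X] {q : E → X} (hq : IsUniversalCovering q) (m : ℕ) :
    CompletelyRegularSpace (DiagOrbitSpace q m) :=
  .of_sheets (continuous_diagCovering hq.isCoveringMap.continuous m)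
    (hq.exists_sheet_diagCovering m)

theorem IsUniversalCovering.t1Space_diagOrbitSpace {E : Type u} {X : Type v}
    [TopologicalSpace E] [TopologicalSpace X] [LocallyPathConnectedSpace X]
    [T1Space X] {q : E → X} (hq : IsUniversalCovering q) (m : ℕ) :
    T1Space (DiagOrbitSpace q m) :=
  .of_sheets (continuous_diagCovering hq.isCoveringMap.continuous m)
    (hq.exists_sheet_diagCovering m)

/-- The diagonal covering restricts to the power of the universal covering over a slice of the
base: a section of the former induces one of the latter. -/
theorem IsUniversalCovering.hasFibreSection_power {E : Type u} {X : Type v}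
    [TopologicalSpace E] [TopologicalSpace X] [LocallyPathConnectedSpace X] [T35Space X]
    {q : E → X} (hq : IsUniversalCovering q) {k n : ℕ}
    (hs : HasFibreSection (diagCovering q (k + 1)) n) :
    HasFibreSection (fun (a : Fin k → E) i => q (a i)) n := by
  haveI := hq.simplyConnected
  haveI := hq.completelyRegularSpace_diagOrbitSpace (k + 1)
  haveI := hq.t1Space_diagOrbitSpace (k + 1)
  haveI : T2Space E := hq.isCoveringMap.t2Space
  obtain ⟨e₀⟩ : Nonempty E := inferInstance
  let Z := DiagOrbitSpace q (k + 1)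
  let mk : (Fin (k + 1) → E) → Z := Quotient.mk (diagSetoid q (k + 1))
  let r : Z → (Fin (k + 1) → X) := diagCovering q (k + 1)
  have hrc : Continuous r := continuous_diagCovering hq.isCoveringMap.continuous _
  let j : (Fin k → E) → Z := fun v => mk (Fin.cons e₀ v)
  have hj : Function.Injective j := by
    intro v w hvw
    obtain ⟨h, hh, hvw⟩ := Quotient.exact hvw
    have h0 : h e₀ = e₀ := (hvw 0).symm
    funext i
    have h1 : w i = h (v i) := hvw i.succ
    rw [h1, hq.deckGroup_apply_eq_self hh h0]
  let A : Set Z := {z | r z 0 = q e₀}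
  have hA : IsClosed A := isClosed_singleton.preimage ((continuous_apply 0).comp hrc)
  have hrange : Set.range j = A := by
    refine Set.Subset.antisymm ?_ fun z hz => ?_
    · rintro _ ⟨v, rfl⟩
      rfl
    · obtain ⟨a, rfl⟩ : ∃ a, mk a = z := Quotient.exists_rep z
      have ha : q (a 0) = q e₀ := hz
      obtain ⟨h, hh, h0⟩ := hq.exists_deckGroup_apply_eq ha
      refine ⟨fun i => h (a i.succ), (Quotient.sound ⟨h, hh, fun i => ?_⟩ :
        mk a = mk (Fin.cons e₀ _)).symm⟩
      refine Fin.cases ?_ (fun i => ?_) i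
      · exact h0.symm
      · rfl
  let T : Z → (Fin k → E) := Function.invFun j
  have hT : ∀ v, T (j v) = v := Function.leftInverse_invFun hj
  have hTA : ContinuousOn T A := by
    rw [← hrange]
    rintro _ ⟨v, rfl⟩
    intro O hO
    rw [hT] at hO
    obtain ⟨φ, heφ, hφ⟩ := hq.isCoveringMap.isLocalHomeomorph e₀
    -- Since `q` is injective on `φ.source`, a tuple in this set whose orbit lies in `A` has first
    -- coordinate exactly `e₀`, so `T` returns its tail.
    have hN : {a : Fin (k + 1) → E | a 0 ∈ φ.source ∧ (fun i => a (Fin.succ i)) ∈ O}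
        ∈ 𝓝 (Fin.cons e₀ v : Fin (k + 1) → E) := by
      refine Filter.inter_mem ?_ ?_
      · exact (continuous_apply 0).continuousAt (φ.open_source.mem_nhds heφ)
      · have hc : Continuous fun (a : Fin (k + 1) → E) (i : Fin k) => a i.succ :=
          continuous_pi fun i => continuous_apply _
        exact hc.continuousAt hO
    refine mem_nhdsWithin_iff_exists_mem_nhds_inter.2
      ⟨_, (DiagOrbitSpace.isOpenMap_mk q (k + 1)).image_mem_nhds hN, ?_⟩
    rintro _ ⟨⟨a, ⟨ha0, haO⟩, rfl⟩, haA⟩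
    rw [hrange] at haA
    have h0 : a 0 = e₀ := φ.injOn ha0 heφ (by rw [← hφ]; exact haA)
    have h1 : a = Fin.cons e₀ fun i => a i.succ := by
      rw [← h0]
      exact (Fin.cons_self_tail a).symm
    have h2 : mk a = j fun i => a i.succ := congrArg mk h1
    change T (mk a) ∈ O
    rw [h2, hT]
    exact haO
  have hTm : @Measurable Z (Fin k → E) (borel Z) (borel (Fin k → E)) T := by
    classical
    letI : MeasurableSpace Z := borel Z
    haveI : BorelSpace Z := ⟨rfl⟩
    letI : MeasurableSpace (Fin k → E) := borel _
    haveI : BorelSpace (Fin k → E) := ⟨rfl⟩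
    -- Off the range of `j`, `Function.invFun` is constant, so `T` is Borel although it may be
    -- discontinuous along the closed set `A`.
    have h1 : T = A.piecewise T fun _ => Classical.arbitrary _ := by
      funext z
      by_cases hz : z ∈ A
      · rw [Set.piecewise_eq_of_mem _ _ _ hz]
      · rw [Set.piecewise_eq_of_notMem _ _ _ hz]
        exact Function.invFun_neg fun h => hz (hrange ▸ h)
    rw [h1]
    exact hTA.measurable_piecewise continuousOn_const hA.measurableSet
  let β : (Fin k → X) → (Fin (k + 1) → X) := fun y => Fin.cons (q e₀) y
  have hβ : Continuous β := by
    refine continuous_pi fun i => Fin.cases ?_ (fun i => ?_) i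
    · exact continuous_const
    · exact continuous_apply i
  have hrβ : ∀ z y, r z = β y → z ∈ A := fun z y h => congrFun h 0
  refine hs.pullback hβ hTm (hTA.mono fun z hz => ?_) fun z y hz => ?_
  · obtain ⟨y, hy⟩ := hz
    exact hrβ z y hy.symm
  · obtain ⟨v, rfl⟩ := hrange.symm ▸ hrβ z y hz
    rw [hT]
    exact funext fun i => congrFun hz i.succ

end DeckTransformations

/-! ### The two inequalities. -/

theorem mainTheorem9 (X : Type*) [TopologicalSpace X] [T35Space X] [ConnectedSpace X]
    [LocallyPathConnectedSpace X] (m : ℕ) (hm : 2 ≤ m) :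
    dcat1 (Fin (m - 1) → X) ≤ dTCD m X ∧ dTCD m X ≤ dcat1 (Fin m → X) := by
  haveI : PathConnectedSpace X := .of_locallyPathConnectedSpace
  obtain ⟨k, rfl⟩ : ∃ k, m = k + 1 := ⟨m - 1, by omega⟩
  rw [Nat.add_sub_cancel]
  constructor
  · refine le_sInf ?_
    rintro _ ⟨E, _, q, hq, rfl⟩
    rw [dcat1_eq_dsecat (hq.pi (ι := Fin k))]
    refine le_sInf ?_
    rintro _ ⟨n, hn, rfl⟩
    exact sInf_le ⟨n, hq.hasFibreSection_power hn, rfl⟩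
  · refine le_sInf ?_
    rintro _ ⟨E', _, p, hp, rfl⟩
    -- The diagonal and the coordinate `0` exhibit `X` as a retract of its power.
    obtain ⟨E, _, q, hq⟩ := hp.exists_of_retract (X := X) (j := fun x _ => x) (r := fun y => y 0)
      (continuous_pi fun _ => continuous_id) (continuous_apply 0) fun _ => rfl
    haveI := hq.t1Space_diagOrbitSpace (k + 1)
    -- Passing through `dcat1` replaces the arbitrary covering `p` of the power by the power of `q`.
    rw [dTCD_eq_dsecat hq, ← dcat1_eq_dsecat hp, dcat1_eq_dsecat (hq.pi (ι := Fin (k + 1)))]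
    exact dsecat_le_of_continuous (DiagOrbitSpace.continuous_mk q (k + 1)) fun _ => rfl
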